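/- A (rooted planar) map is a finite connected graph (loops and multiple edges allowed) embedded in the sphere, with a marked oriented edge, its root edge; two maps are identified if an orientation-preserving homeomorphism of the sphere carries one onto the other together with the root edges. A tree is a map with a single face. A tree-decorated map with root edge on the tree is a pair $(\mathfrak m,\mathfrak t)$ where $\mathfrak m$ is a map and $\mathfrak t$ is a submap of $\mathfrak m$ that is a tree containing the root edge of $\mathfrak m$; then $\mathfrak t$ is rooted at this edge. A map with a simple boundary of size $2m$ and $e$ interior edges is a map whose external face, the face lying to the left of the root edge, has degree $2m$ and is bounded by a simple closed curve (no vertex is visited twice and no edge is run along twice), and which has exactly $e$ edges not incident to the external face. Theorem. Let $e,m\ge 0$ be integers. The set of tree-decorated maps with $e+m$ edges, decorated by a tree with $m$ edges and with root edge on the tree, is in bijection with the Cartesian product of the set of trees with $m$ edges and the set of maps with a simple boundary of size $2m$ and $e$ interior edges. (For $m=0$ both sets are empty, since a map has a root edge.) More precisely, there is such a bijection in which $(\mathfrak m,\mathfrak t)$ corresponds to $(\mathfrak t',\mathfrak m^b)$ if and only if $(\mathfrak m,\mathfrak t)$ is obtained by gluing the boundary of $\mathfrak m^b$ along $\mathfrak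 t'$: the rooted tree $\mathfrak t$ is a copy of $\mathfrak t'$; for every $i\ge 0$, the $i$-th oriented edge of the boundary of $\mathfrak m^b$ (starting from the root edge and walking with the external face on the left) is identified with the $i$-th oriented edge of the contour of $\mathfrak t'$ (starting from the root edge and walking around the tree with the tree on the left hand); and, apart from this identification, the oriented edges that do not lie on the boundary and the internal faces of $\mathfrak m^b$ become, unchanged, the oriented edges and the faces of $\mathfrak m$. -/

import Mathlib

/-- The orbits (cycles, fixed points included) of a permutation. -/
abbrev Orbits {α : Type} (p : Equiv.Perm α) : Type :=
  Quotient (Equiv.Perm.SameCycle.setoid p)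

/-- A rooted planar map (connected finite graph embedded in the sphere, loops and multiple edges
allowed, with a marked oriented edge), presented by its oriented edges (darts): `rev` reverses an
oriented edge, `rot` sends an oriented edge to the next one, in clockwise order, among the oriented
edges with the same starting vertex. Vertices, edges and faces are the orbits of `rot`, of `rev`
and of `rot * rev`; the orbit of `d` under `rot * rev` lists the oriented edges having at their left
the face that lies to the left of `d`. The surface is the sphere exactly when Euler's
relation holds. -/
structure RootedMap : Type 1 where
  Dart : Type
  finite_dart : Finite Dart
  rev : Equiv.Perm Dart
  rot : Equiv.Perm Dart
  root : Dart
  rev_rev : ∀ d, rev (rev d) = d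
  rev_ne : ∀ d, rev d ≠ d
  connected : ∀ d d' : Dart, ∃ g ∈ Subgroup.closure {rev, rot}, g d = d'
  euler : Nat.card (Orbits rot) + Nat.card (Orbits (rot * rev)) = Nat.card (Orbits rev) + 2

namespace RootedMap

/-- The next oriented edge along the face lying to the left. -/
def face (M : RootedMap) : Equiv.Perm M.Dart := M.rot * M.rev

noncomputable def numFaces (M : RootedMap) : ℕ := Nat.card (Orbits M.face)

noncomputable def numEdges (M : RootedMap) : ℕ := Nat.card (Orbits M.rev)

/-- The next oriented edge for a walker that keeps the map at its left hand, that is, who walks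
along the face lying to the right. -/
def contour (M : RootedMap) : Equiv.Perm M.Dart := M.rot⁻¹ * M.rev

/-- Rooted maps are the same when an orientation preserving homeomorphism of the sphere
identifies them, i.e. when a bijection of the oriented edges preserves reversal, the cyclic orders
around the vertices, and the root. -/
def IsIso (M N : RootedMap) (φ : M.Dart ≃ N.Dart) : Prop :=
  (∀ d, φ (M.rev d) = N.rev (φ d)) ∧ (∀ d, φ (M.rot d) = N.rot (φ d)) ∧ φ M.root = N.root

theorem IsIso.refl (M : RootedMap) : IsIso M M (Equiv.refl _) :=
  ⟨fun _ => rfl, fun _ => rfl, rfl⟩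

theorem IsIso.symm {M N : RootedMap} {φ : M.Dart ≃ N.Dart} (h : IsIso M N φ) :
    IsIso N M φ.symm := by
  refine ⟨fun d => ?_, fun d => ?_, ?_⟩
  · rw [Equiv.symm_apply_eq, h.1, Equiv.apply_symm_apply]
  · rw [Equiv.symm_apply_eq, h.2.1, Equiv.apply_symm_apply]
  · rw [Equiv.symm_apply_eq, h.2.2]

theorem IsIso.trans {M N P : RootedMap} {φ : M.Dart ≃ N.Dart} {ψ : N.Dart ≃ P.Dart}
    (h : IsIso M N φ) (k : IsIso N P ψ) : IsIso M P (φ.trans ψ) :=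
  ⟨fun d => by simp [h.1, k.1], fun d => by simp [h.2.1, k.2.1], by simp [h.2.2, k.2.2]⟩

instance setoid : Setoid RootedMap where
  r M N := ∃ φ, IsIso M N φ
  iseqv := ⟨fun M => ⟨_, IsIso.refl M⟩, fun ⟨_, h⟩ => ⟨_, h.symm⟩,
    fun ⟨_, h⟩ ⟨_, k⟩ => ⟨_, h.trans k⟩⟩

/-- A planted plane tree: a rooted map with a single face. -/
def IsTree (M : RootedMap) : Prop := M.numFaces = 1

/-- `ι` exhibits `N` as the map obtained from `M` by suppressing the edges outside the
range of `ι` (and the vertices left without edges): the successor of an oriented edge of `N`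
around its starting vertex is the first remaining one that is met when turning in `M`. -/
def IsSubmap (N M : RootedMap) (ι : N.Dart → M.Dart) : Prop :=
  Function.Injective ι ∧ (∀ d, ι (N.rev d) = M.rev (ι d)) ∧
    ∀ d, ∃ k : ℕ, 0 < k ∧ (M.rot ^ k) (ι d) = ι (N.rot d) ∧
      ∀ j : ℕ, 0 < j → j < k → (M.rot ^ j) (ι d) ∉ Set.range ι

/-- `ι` exhibits the planted plane tree `t` as a submap of `M` with edge set (given by its
oriented edges) `T`, the root edge of `t` being that of `M`. -/
def IsRootedSubtree (t M : RootedMap) (T : Set M.Dart) (ι : t.Dart → M.Dart) : Prop :=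
  t.IsTree ∧ IsSubmap t M ι ∧ ι t.root = M.root ∧ Set.range ι = T

/-- The boundary: the oriented edges incident to the external face, which is the face to the left
of the root edge. -/
def boundary (M : RootedMap) : Set M.Dart := {d | M.face.SameCycle M.root d}

/-- The boundary is simple: as a closed curve, it neither visits a vertex twice nor runs
twice along the same edge. -/
def HasSimpleBoundary (M : RootedMap) : Prop :=
  (∀ d ∈ M.boundary, ∀ d' ∈ M.boundary, M.rot.SameCycle d d' → d = d') ∧
    ∀ d ∈ M.boundary, M.rev d ∉ M.boundary

/-- The number of edges that are not incident to the external face. -/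
noncomputable def numInteriorEdges (M : RootedMap) : ℕ :=
  Nat.card {ε : Orbits M.rev // ∀ d : M.Dart, (Quotient.mk _ d : Orbits M.rev) = ε →
    d ∉ M.boundary}

end RootedMap

/-- A representative of a planted plane tree with `m` edges. -/
structure TreeRep (m : ℕ) : Type 1 where
  map : RootedMap
  isTree : map.IsTree
  numEdges_eq : map.numEdges = m

/-- A representative of a map with a simple boundary of size `2 * m` and `e` interior edges. -/
structure BoundaryMapRep (e m : ℕ) : Type 1 where
  map : RootedMap
  simple : map.HasSimpleBoundary
  boundary_size : Nat.card map.boundary = 2 * m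
  numInteriorEdges_eq : map.numInteriorEdges = e

/-- A representative of a tree-decorated map with `e + m` edges, decorated by a subtree with
`m` edges (given by the set `tree` of its oriented edges) that contains the root edge. -/
structure DecoratedMapRep (e m : ℕ) : Type 1 where
  map : RootedMap
  numEdges_eq : map.numEdges = e + m
  tree : Set map.Dart
  isTree : ∃ t : RootedMap, t.numEdges = m ∧ ∃ ι, RootedMap.IsRootedSubtree t map tree ι

instance TreeRep.setoid (m : ℕ) : Setoid (TreeRep m) :=
  RootedMap.setoid.comap TreeRep.map

instance BoundaryMapRep.setoid (e m : ℕ) : Setoid (BoundaryMapRep e m) :=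
  RootedMap.setoid.comap BoundaryMapRep.map

/-- Decorated maps are the same when an isomorphism of rooted maps carries one decorating tree
onto the other. -/
instance DecoratedMapRep.setoid (e m : ℕ) : Setoid (DecoratedMapRep e m) where
  r X Y := ∃ φ, RootedMap.IsIso X.map Y.map φ ∧ φ '' X.tree = Y.tree
  iseqv := ⟨fun X => ⟨_, RootedMap.IsIso.refl X.map, by simp⟩,
    fun ⟨φ, h, k⟩ => ⟨_, h.symm, by rw [← k, Equiv.symm_image_image]⟩,
    fun ⟨φ, h, k⟩ ⟨ψ, h', k'⟩ => ⟨_, h.trans h', by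
      rw [← k', ← k, Set.image_image]; rfl⟩⟩

/-- The set of planted plane trees with `m` edges. -/
def PlaneTree (m : ℕ) : Type 1 := Quotient (TreeRep.setoid m)

/-- The set of maps with a simple boundary of size `2 * m` and `e` interior edges. -/
def SimpleBoundaryMap (e m : ℕ) : Type 1 := Quotient (BoundaryMapRep.setoid e m)

/-- The set of tree-decorated maps with `e + m` edges, decorated by a tree with `m` edges, with
root edge on the tree. -/
def TreeDecoratedMap (e m : ℕ) : Type 1 := Quotient (DecoratedMapRep.setoid e m)

def TreeRep.toPlaneTree {m : ℕ} (t : TreeRep m) : PlaneTree m :=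
  Quotient.mk _ t

def BoundaryMapRep.toSimpleBoundaryMap {e m : ℕ} (B : BoundaryMapRep e m) :
    SimpleBoundaryMap e m :=
  Quotient.mk _ B

def DecoratedMapRep.toTreeDecoratedMap {e m : ℕ} (X : DecoratedMapRep e m) :
    TreeDecoratedMap e m :=
  Quotient.mk _ X

/-- The decorated map `X` is obtained by gluing the boundary of `B` along the tree `t`. The
decorating tree of `X` is a copy `ι` of `t`; the `i`-th oriented edge of the boundary of `B`, from
its root edge, becomes the `i`-th oriented edge of the contour of `t`, from its root edge; apart
from this identification, the oriented edges of `X` are those of `B` which are not in its boundary,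
and the internal faces of `B` become the faces of `X` without change. -/
def IsGluing {e m : ℕ} (t : TreeRep m) (B : BoundaryMapRep e m) (X : DecoratedMapRep e m) : Prop :=
  ∃ (ι : t.map.Dart → X.map.Dart) (f : B.map.Dart → X.map.Dart),
    RootedMap.IsRootedSubtree t.map X.map X.tree ι ∧
    (∀ d, f (B.map.rev d) = X.map.rev (f d)) ∧
    (∀ i : ℕ, f ((B.map.face ^ i) B.map.root) = ι ((t.map.contour ^ i) t.map.root)) ∧
    Set.BijOn f (B.map.boundary)ᶜ Set.univ ∧
    ∀ d ∉ B.map.boundary, f (B.map.face d) = X.map.face (f d)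

/-! Cut the map open along the decorating tree. Each tree edge splits into two edges, and the slit
becomes a new face whose boundary is the contour of the tree. On oriented edges, the cut map `B` of
`X` along `t` has those of `X` together with one new one for each oriented edge of `t`. Its face
permutation is that of `X` beside the contour of `t`. Only the reversal is rewired, along the tree.
Since rotation is face composed with reversal, these data determine `B`. This relation is `IsCut`,
and a gluing is the same thing as a cut read backwards (`IsGluing.exists_isCutMap`,
`isGluing_of_isCutMap`).

The central point is local. Turning around a vertex of `B` from a boundary edge follows the turning
in `X` up to the next tree edge and then closes up. Hence `t` is a submap of `X` exactly when each
boundary edge of `B` is the only one at its starting vertex (`isFirstReturn_inr`,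
`isFirstReturn_tree`), which is half of boundary simplicity. The other half, that no edge is run
along twice, comes from the rewired reversal.

Cutting adds one face and as many edges as `t` has. The vertices of `t` are replaced by one vertex
for each corner of `t`, that is, twice its number of edges. As `t` has one more vertex than edges,
Euler's relation passes both ways (`isSpherical_iff`). Connectedness also passes both ways.

The bijection follows from four facts: every decorated map can be cut, every pair can be glued, a
decorated map determines its tree and cut map up to isomorphism, and a pair determines its gluing up
to isomorphism. -/

/-! ### First return maps and orbit counts -/

/-- The permutation `q` is the first return map of `p` to the range of `ι`. -/
def IsFirstReturn {α β : Type} (p : Equiv.Perm α) (q : Equiv.Perm β) (ι : β → α) : Prop :=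
  ∀ d, ∃ k : ℕ, 0 < k ∧ (p ^ k) (ι d) = ι (q d) ∧
    ∀ j : ℕ, 0 < j → j < k → (p ^ j) (ι d) ∉ Set.range ι

/-- The orbits of `p` that do not meet `S`. -/
abbrev AvoidingOrbits {α : Type} (p : Equiv.Perm α) (S : Set α) : Type :=
  {o : Orbits p // ∀ d : α, (Quotient.mk _ d : Orbits p) = o → d ∉ S}

theorem orbit_mk_eq_iff {α : Type} {p : Equiv.Perm α} {x y : α} :
    (Quotient.mk _ x : Orbits p) = Quotient.mk _ y ↔ p.SameCycle x y :=
  Quotient.eq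

theorem exists_pow_eq_of_sameCycle {α : Type} [Finite α] {p : Equiv.Perm α} {x y : α}
    (h : p.SameCycle x y) : ∃ n : ℕ, (p ^ n) x = y := by
  obtain ⟨i, -, h⟩ := h.exists_pow_eq'
  exact ⟨i, h⟩

theorem sameCycle_of_pow_eq {α : Type} {p : Equiv.Perm α} {x y : α} {n : ℕ}
    (h : (p ^ n) x = y) : p.SameCycle x y :=
  ⟨n, by simpa using h⟩

namespace IsFirstReturn

variable {α β : Type} {p : Equiv.Perm α} {q : Equiv.Perm β} {ι : β → α}

theorem sameCycle_apply (h : IsFirstReturn p q ι) (d : β) : p.SameCycle (ι d) (ι (q d)) := by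
  obtain ⟨k, -, h, -⟩ := h d
  exact sameCycle_of_pow_eq h

/-- A positive `n` is at least the first return time, so the path can jump to `ι (q d)` with a
smaller exponent left. -/
theorem sameCycle_of_pow (hι : Function.Injective ι) (h : IsFirstReturn p q ι) {d' : β} (n : ℕ) :
    ∀ d, (p ^ n) (ι d) = ι d' → q.SameCycle d d' := by
  induction n using Nat.strong_induction_on with
  | _ n ih =>
    intro d hd
    rcases Nat.eq_zero_or_pos n with rfl | hn
    · rw [hι (a₁ := d) (a₂ := d') (by simpa using hd)]
    obtain ⟨k, hk, hkd, hlt⟩ := h d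
    have hkn : k ≤ n := by
      by_contra! hnk
      exact hlt n hn hnk ⟨d', hd.symm⟩
    have := ih (n - k) (by omega) (q d) (by
      rw [← hkd, ← Equiv.Perm.mul_apply, ← pow_add, Nat.sub_add_cancel hkn, hd])
    exact (Equiv.Perm.sameCycle_apply_left).1 this

theorem sameCycle_iff [Finite α] [Finite β] (hι : Function.Injective ι)
    (h : IsFirstReturn p q ι) {d d' : β} : p.SameCycle (ι d) (ι d') ↔ q.SameCycle d d' := by
  constructor
  · intro hd
    obtain ⟨n, hn⟩ := exists_pow_eq_of_sameCycle hd
    exact h.sameCycle_of_pow hι n d hn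
  · intro hd
    obtain ⟨n, rfl⟩ := exists_pow_eq_of_sameCycle hd
    clear hd
    induction n with
    | zero => exact Equiv.Perm.SameCycle.refl _ _
    | succ n ih =>
      rw [pow_succ', Equiv.Perm.mul_apply]
      exact ih.trans (h.sameCycle_apply _)

theorem unique (hι : Function.Injective ι) (h : IsFirstReturn p q ι) {q' : Equiv.Perm β}
    (h' : IsFirstReturn p q' ι) : q = q' := by
  ext d
  obtain ⟨k, hk, hkd, hlt⟩ := h d
  obtain ⟨k', hk', hkd', hlt'⟩ := h' d
  have : k = k' := by
    rcases lt_trichotomy k k' with hl | hl | hl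
    · exact absurd ⟨_, hkd.symm⟩ (hlt' k hk hl)
    · exact hl
    · exact absurd ⟨_, hkd'.symm⟩ (hlt k' hk' hl)
  subst this
  exact hι (hkd.symm.trans hkd')

theorem card_orbits [Finite α] [Finite β] (hι : Function.Injective ι)
    (h : IsFirstReturn p q ι) :
    Nat.card (Orbits p) = Nat.card (Orbits q) + Nat.card (AvoidingOrbits p (Set.range ι)) := by
  have : Nat.card (Orbits q) =
      Nat.card {o : Orbits p // ¬ ∀ d : α, (Quotient.mk _ d : Orbits p) = o → d ∉ Set.range ι} := by
    refine Nat.card_congr (Equiv.ofBijective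
      (Quotient.lift (fun d => ⟨Quotient.mk _ (ι d), fun h => h _ rfl ⟨d, rfl⟩⟩) ?_) ⟨?_, ?_⟩)
    · intro a b hab
      exact Subtype.ext (orbit_mk_eq_iff.2 ((h.sameCycle_iff hι).2 hab))
    · intro a b
      induction a using Quotient.inductionOn
      induction b using Quotient.inductionOn
      intro hab
      exact Quotient.sound ((h.sameCycle_iff hι).1 (orbit_mk_eq_iff.1 (Subtype.ext_iff.1 hab)))
    · rintro ⟨o, ho⟩
      push Not at ho
      obtain ⟨_, rfl, d, rfl⟩ := ho
      exact ⟨Quotient.mk _ d, rfl⟩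
  classical
  rw [this, add_comm, ← Nat.card_sum]
  exact Nat.card_congr (Equiv.sumCompl _).symm

end IsFirstReturn

/-- If no two distinct points of the range of `ι` are on the same cycle of `p`, then `p` returns to
this range where it left it. -/
theorem isFirstReturn_one {α β : Type} [Finite α] {p : Equiv.Perm α} {ι : β → α}
    (h : ∀ c c', p.SameCycle (ι c) (ι c') → ι c = ι c') : IsFirstReturn p 1 ι := by
  classical
  intro c
  have hex : ∃ k, 0 < k ∧ (p ^ k) (ι c) ∈ Set.range ι :=
    ⟨orderOf p, orderOf_pos p, c, by simp [pow_orderOf_eq_one]⟩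
  refine ⟨Nat.find hex, (Nat.find_spec hex).1, ?_, fun j hj hlt hmem =>
    Nat.find_min hex hlt ⟨hj, hmem⟩⟩
  obtain ⟨c', hc'⟩ := (Nat.find_spec hex).2
  rw [← hc']
  exact (h c c' (sameCycle_of_pow_eq hc'.symm)).symm

/-- Along an orbit that avoids `S`, `j` intertwines `p` and `p'`. By `hmem`, an orbit that enters
`S` is sent into `S'` at the next step, so orbits avoiding `S'` come only from orbits avoiding `S`.
This matches the vertices of a map off the tree with the vertices of its cut off the boundary and,
with `S` empty, the old faces with the inner ones. -/
theorem card_avoidingOrbits_congr {α α' : Type} [Finite α] [Finite α'] {p : Equiv.Perm α}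
    {p' : Equiv.Perm α'} {S : Set α} {S' : Set α'} {j : α → α'} (hj : Function.Injective j)
    (hnot : ∀ d, j d ∉ S') (hcover : ∀ x ∉ S', ∃ d, j d = x)
    (hmem : ∀ d ∈ S, p' (j d) ∈ S') (hcomm : ∀ d ∉ S, p' (j d) = j (p d)) :
    Nat.card (AvoidingOrbits p S) = Nat.card (AvoidingOrbits p' S') := by
  have key : ∀ d, (∀ n : ℕ, (p ^ n) d ∉ S) → ∀ n : ℕ, (p' ^ n) (j d) = j ((p ^ n) d) := by
    intro d hd n
    induction n with
    | zero => rfl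
    | succ n ih =>
      rw [pow_succ', pow_succ', Equiv.Perm.mul_apply, Equiv.Perm.mul_apply, ih, hcomm _ (hd n)]
  have out : ∀ o : AvoidingOrbits p S, ∀ n : ℕ, (p ^ n) o.1.out ∉ S := by
    intro o n
    apply o.2
    conv_rhs => rw [← Quotient.out_eq o.1]
    exact orbit_mk_eq_iff.2 (sameCycle_of_pow_eq rfl).symm
  refine Nat.card_congr (Equiv.ofBijective
    (fun o => ⟨Quotient.mk _ (j o.1.out), fun x hx => ?_⟩) ⟨fun a b hab => ?_, fun o => ?_⟩)
  · obtain ⟨n, rfl⟩ := exists_pow_eq_of_sameCycle (orbit_mk_eq_iff.1 hx).symm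
    rw [key _ (out o)]
    exact hnot _
  · obtain ⟨n, hn⟩ := exists_pow_eq_of_sameCycle (orbit_mk_eq_iff.1 (Subtype.ext_iff.1 hab))
    rw [key _ (out a)] at hn
    refine Subtype.ext ?_
    rw [← Quotient.out_eq a.1, ← Quotient.out_eq b.1]
    exact orbit_mk_eq_iff.2 (sameCycle_of_pow_eq (hj hn))
  · obtain ⟨o, ho⟩ := o
    induction o using Quotient.inductionOn with
    | _ x =>
    obtain ⟨d, rfl⟩ := hcover x (ho x rfl)
    have hd : ∀ n : ℕ, (p ^ n) d ∉ S ∧ (p' ^ n) (j d) = j ((p ^ n) d) := by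
      have aux : ∀ n : ℕ, (p' ^ n) (j d) = j ((p ^ n) d) → (p ^ n) d ∉ S := by
        intro n hn hS
        refine ho _ ?_ (hmem _ hS)
        rw [← hn, ← Equiv.Perm.mul_apply, ← pow_succ']
        exact orbit_mk_eq_iff.2 (sameCycle_of_pow_eq rfl).symm
      intro n
      induction n with
      | zero => exact ⟨aux 0 rfl, rfl⟩
      | succ n ih =>
        have : (p' ^ (n + 1)) (j d) = j ((p ^ (n + 1)) d) := by
          rw [pow_succ', pow_succ', Equiv.Perm.mul_apply, Equiv.Perm.mul_apply, ih.2, hcomm _ ih.1]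
        exact ⟨aux _ this, this⟩
    have hav : ∀ y : α, (Quotient.mk _ y : Orbits p) = Quotient.mk _ d → y ∉ S := by
      intro y hy
      obtain ⟨n, rfl⟩ := exists_pow_eq_of_sameCycle (orbit_mk_eq_iff.1 hy).symm
      exact (hd n).1
    refine ⟨⟨Quotient.mk _ d, hav⟩, Subtype.ext (orbit_mk_eq_iff.2 ?_)⟩
    obtain ⟨n, hn⟩ := exists_pow_eq_of_sameCycle
      (orbit_mk_eq_iff.1 (Quotient.out_eq (Quotient.mk _ d : Orbits p))).symm
    refine (sameCycle_of_pow_eq (n := n) ?_).symm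
    rw [(hd n).2, hn]

theorem card_avoidingOrbits_empty {α : Type} (p : Equiv.Perm α) :
    Nat.card (AvoidingOrbits p ∅) = Nat.card (Orbits p) :=
  Nat.card_congr (Equiv.subtypeUnivEquiv fun _ _ _ => Set.notMem_empty _)

theorem card_orbits_one (α : Type) : Nat.card (Orbits (1 : Equiv.Perm α)) = Nat.card α := by
  refine Nat.card_congr (Equiv.ofBijective (fun a => Quotient.mk _ a) ⟨fun a b h => ?_, ?_⟩).symm
  · exact Equiv.Perm.sameCycle_one.1 (orbit_mk_eq_iff.1 h)
  · exact Quotient.mk_surjective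

/-! ### Involutions and labelled cycles -/

theorem sameCycle_involution_iff {α : Type} {p : Equiv.Perm α} (hp : ∀ d, p (p d) = d) {x y : α} :
    p.SameCycle x y ↔ y = x ∨ y = p x := by
  constructor
  · rintro ⟨n, rfl⟩
    have h2 : p * p = 1 := Equiv.ext hp
    rcases Int.even_or_odd' n with ⟨k, rfl | rfl⟩
    · left; rw [zpow_mul, zpow_two, h2, one_zpow]; rfl
    · right; rw [zpow_add, zpow_mul, zpow_two, h2, one_zpow]; simp
  · rintro (rfl | rfl)
    · exact Equiv.Perm.SameCycle.refl _ _
    · exact Equiv.Perm.sameCycle_apply_right.2 (Equiv.Perm.SameCycle.refl _ _)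

theorem card_eq_two_mul_card_orbits {α : Type} {p : Equiv.Perm α} (hp : ∀ d, p (p d) = d)
    (hne : ∀ d, p d ≠ d) : Nat.card α = 2 * Nat.card (Orbits p) := by
  have hmk : ∀ o : Orbits p, (Quotient.mk _ (p o.out) : Orbits p) = o := fun o => by
    conv_rhs => rw [← Quotient.out_eq o]
    exact orbit_mk_eq_iff.2 (Equiv.Perm.sameCycle_apply_left.2 (Equiv.Perm.SameCycle.refl _ _))
  have : Nat.card (Bool × Orbits p) = Nat.card α := by
    refine Nat.card_congr (Equiv.ofBijective
      (fun x : Bool × Orbits p => bif x.1 then x.2.out else p x.2.out) ⟨?_, fun a => ?_⟩)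
    · have hq : ∀ x : Bool × Orbits p,
          (Quotient.mk _ (bif x.1 then x.2.out else p x.2.out) : Orbits p) = x.2 := by
        rintro ⟨_ | _, o⟩
        · exact hmk o
        · exact Quotient.out_eq o
      intro x y hxy
      have h2 : x.2 = y.2 := by
        rw [← hq x, ← hq y]; exact congrArg _ hxy
      obtain ⟨b, o⟩ := x
      obtain ⟨b', o'⟩ := y
      obtain rfl : o = o' := h2
      have h := hne o.out
      cases b <;> cases b'
      · rfl
      · exact absurd hxy h
      · exact absurd hxy.symm h
      · rfl
    · rcases (sameCycle_involution_iff hp).1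
        (orbit_mk_eq_iff.1 (Quotient.out_eq (Quotient.mk _ a : Orbits p))) with h | h
      · exact ⟨(true, Quotient.mk _ a), h.symm⟩
      · exact ⟨(false, Quotient.mk _ a), h.symm⟩
  rw [← this, Nat.card_prod]
  simp

theorem zpow_apply_eq_self_iff_card_dvd {α : Type} [Finite α] (p : Equiv.Perm α) (a : α) (n : ℤ) :
    (p ^ n) a = a ↔ (Nat.card {x | p.SameCycle a x} : ℤ) ∣ n := by
  have : Fintype (MulAction.orbit (Subgroup.zpowers p) a) := Fintype.ofFinite _
  have h := MulAction.zpow_smul_eq_iff_minimalPeriod_dvd (a := p) (b := a) (n := n)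
  rw [MulAction.minimalPeriod_eq_card] at h
  have hset : MulAction.orbit (Subgroup.zpowers p) a = {x | p.SameCycle a x} := by
    ext x
    constructor
    · rintro ⟨⟨_, i, rfl⟩, rfl⟩
      exact ⟨i, rfl⟩
    · rintro ⟨i, rfl⟩
      exact ⟨⟨_, i, rfl⟩, rfl⟩
  rw [← hset, Nat.card_eq_fintype_card]
  exact h

theorem zpow_apply_eq_zpow_apply_iff {α : Type} [Finite α] (p : Equiv.Perm α) (a : α) (m n : ℤ) :
    (p ^ m) a = (p ^ n) a ↔ (Nat.card {x | p.SameCycle a x} : ℤ) ∣ m - n := by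
  rw [← zpow_apply_eq_self_iff_card_dvd, sub_eq_neg_add, zpow_add, zpow_neg, Equiv.Perm.mul_apply,
    Equiv.Perm.inv_eq_iff_eq]

/-- Two cyclic orbits of the same size are isomorphic. -/
theorem exists_orbit_labelling {α β : Type} [Finite α] [Finite β] {p : Equiv.Perm α}
    {q : Equiv.Perm β} (a : α) (b : β) (hq : ∀ y, q.SameCycle b y)
    (hcard : Nat.card {x | p.SameCycle a x} = Nat.card β) :
    ∃ φ : β → α, Function.Injective φ ∧ Set.range φ = {x | p.SameCycle a x} ∧
      φ b = a ∧ ∀ y, φ (q y) = p (φ y) := by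
  have hcard' : Nat.card {x | p.SameCycle a x} = Nat.card {y | q.SameCycle b y} := by
    rw [hcard, show {y | q.SameCycle b y} = Set.univ from Set.eq_univ_of_forall hq]
    exact (Nat.card_congr (Equiv.Set.univ β)).symm
  have key : ∀ m n : ℤ, (p ^ m) a = (p ^ n) a ↔ (q ^ m) b = (q ^ n) b := fun m n => by
    rw [zpow_apply_eq_zpow_apply_iff, zpow_apply_eq_zpow_apply_iff, hcard']
  choose n hn using hq
  -- The exponents `n y` are arbitrary choices; by `key` the value depends only on `y`.
  refine ⟨fun y => (p ^ n y) a, fun y z h => ?_, ?_, ?_, fun y => ?_⟩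
  · rw [← hn y, ← hn z]
    exact (key _ _).1 h
  · ext x
    constructor
    · rintro ⟨y, rfl⟩
      exact ⟨_, rfl⟩
    · rintro ⟨i, rfl⟩
      exact ⟨(q ^ i) b, (key _ _).2 (hn _)⟩
  · exact (key (n b) 0).2 (hn b)
  · change (p ^ n (q y)) a = p ((p ^ n y) a)
    rw [← Equiv.Perm.mul_apply, ← zpow_one_add, key, hn, zpow_one_add, Equiv.Perm.mul_apply, hn]

/-- By finiteness forward iterates exhaust a cycle, so invariance under the inverse comes for free.
-/
theorem apply_of_apply_perm {α : Type} [Finite α] {p : Equiv.Perm α} {P : α → Prop}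
    (h : ∀ d, P d → P (p d)) {x y : α} (hxy : p.SameCycle x y) (hx : P x) : P y := by
  obtain ⟨n, rfl⟩ := exists_pow_eq_of_sameCycle hxy
  clear hxy
  induction n with
  | zero => exact hx
  | succ n ih =>
    rw [pow_succ', Equiv.Perm.mul_apply]
    exact h _ ih

/-! ### Rotation systems -/

/-- A map on an oriented surface, possibly not connected, presented by its oriented edges. -/
structure RotationSystem (α : Type) where
  rev : Equiv.Perm α
  rot : Equiv.Perm α
  rev_rev : ∀ d, rev (rev d) = d
  rev_ne : ∀ d, rev d ≠ d

namespace RotationSystem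

variable {α : Type}

def face (S : RotationSystem α) : Equiv.Perm α := S.rot * S.rev

def contour (S : RotationSystem α) : Equiv.Perm α := S.rot⁻¹ * S.rev

def IsConnected (S : RotationSystem α) : Prop :=
  ∀ d d' : α, ∃ g ∈ Subgroup.closure {S.rev, S.rot}, g d = d'

def IsSpherical (S : RotationSystem α) : Prop :=
  Nat.card (Orbits S.rot) + Nat.card (Orbits S.face) = Nat.card (Orbits S.rev) + 2

theorem face_rev (S : RotationSystem α) (d : α) : S.face (S.rev d) = S.rot d := by
  rw [face, Equiv.Perm.mul_apply, S.rev_rev]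

/-- Reversing every edge turns the walk along the right-hand face into a face walk run backwards.
Hence the contour of a one-face map is a single cycle. -/
theorem contour_eq_conj (S : RotationSystem α) : S.contour = S.rev⁻¹ * S.face⁻¹ * S.rev := by
  have : S.rev * S.rev = 1 := Equiv.ext S.rev_rev
  rw [contour, face, mul_inv_rev, ← mul_assoc, ← mul_inv_rev, this]
  simp

theorem sameCycle_contour (S : RotationSystem α) (h : Nat.card (Orbits S.face) = 1) (d d' : α) :
    S.contour.SameCycle d d' := by
  have := (Nat.card_eq_one_iff_unique.1 h).1
  have hf : S.face.SameCycle (S.rev d) (S.rev d') := orbit_mk_eq_iff.1 (Subsingleton.elim _ _)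
  rw [contour_eq_conj]
  have := (Equiv.Perm.sameCycle_inv.2 hf).conj (g := S.rev⁻¹)
  simpa using this

theorem card_eq (S : RotationSystem α) : Nat.card α = 2 * Nat.card (Orbits S.rev) :=
  card_eq_two_mul_card_orbits S.rev_rev S.rev_ne

/-- Invariance is tested on `rev` and `face` because a cut is specified through these two
permutations; `rot` is recovered as their product. -/
theorem isConnected_iff [Finite α] (S : RotationSystem α) :
    S.IsConnected ↔ ∀ P : α → Prop, (∀ d, P d → P (S.rev d)) → (∀ d, P d → P (S.face d)) →
      ∀ d d', P d → P d' := by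
  constructor
  · intro h P hrev hface d d' hd
    obtain ⟨g, hg, rfl⟩ := h d d'
    have hrot : ∀ d, P d → P (S.rot d) := fun d hd => S.face_rev d ▸ hface _ (hrev _ hd)
    have inv : ∀ p : Equiv.Perm α, (∀ d, P d → P (p d)) → ∀ d, P d → P (p⁻¹ d) :=
      fun p hp d hd => apply_of_apply_perm hp
        ⟨-1, by rw [zpow_neg_one]⟩ hd
    suffices ∀ d, P d → P (g d) from this d hd
    induction hg using Subgroup.closure_induction with
    | mem x hx =>
      rcases hx with rfl | rfl
      · exact hrev
      · exact hrot
    | one => exact fun d hd => hd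
    | mul x y _ _ hx hy => exact fun d hd => hx _ (hy _ hd)
    | inv x _ hx => exact inv x hx
  · intro h d d'
    have hrev := Subgroup.subset_closure (show S.rev ∈ ({S.rev, S.rot} : Set _) by simp)
    have hrot := Subgroup.subset_closure (show S.rot ∈ ({S.rev, S.rot} : Set _) by simp)
    refine h (fun x => ∃ g ∈ Subgroup.closure {S.rev, S.rot}, g d = x) ?_ ?_ d d'
      ⟨1, one_mem _, rfl⟩
    · rintro _ ⟨g, hg, rfl⟩
      exact ⟨S.rev * g, mul_mem hrev hg, rfl⟩
    · rintro _ ⟨g, hg, rfl⟩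
      exact ⟨S.face * g, mul_mem (mul_mem hrot hrev) hg, rfl⟩

end RotationSystem

/-! ### Cutting along a subsystem -/

variable {D T A : Type}

/-- The rotation system `B` is obtained by cutting `X` open along the edges of its subsystem `t`:
its oriented edges are those of `X` (via `inl`) and one oriented edge `inr c` for each oriented
edge `c` of `t`, that runs along `c` on its right and has the newly created face to its left. -/
structure IsCut (X : RotationSystem D) (t : RotationSystem T) (B : RotationSystem A)
    (ι : T → D) (inl : D → A) (inr : T → A) : Prop where
  injective : Function.Injective ι
  map_rev : ∀ c, ι (t.rev c) = X.rev (ι c)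
  inl_injective : Function.Injective inl
  inr_injective : Function.Injective inr
  inl_ne_inr : ∀ d c, inl d ≠ inr c
  cover : ∀ a, (∃ d, inl d = a) ∨ ∃ c, inr c = a
  rev_inr : ∀ c, B.rev (inr c) = inl (X.rev (ι c))
  rev_inl : ∀ d ∉ Set.range ι, B.rev (inl d) = inl (X.rev d)
  face_inl : ∀ d, B.face (inl d) = inl (X.face d)
  face_inr : ∀ c, B.face (inr c) = inr (t.contour c)

namespace IsCut

variable {X : RotationSystem D} {t : RotationSystem T} {B : RotationSystem A}
  {ι : T → D} {inl : D → A} {inr : T → A}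

theorem rev_inl_tree (h : IsCut X t B ι inl inr) (c : T) :
    B.rev (inl (ι c)) = inr (t.rev c) := by
  rw [← B.rev_rev (inr (t.rev c)), h.rev_inr, h.map_rev, X.rev_rev]

theorem rot_inr (h : IsCut X t B ι inl inr) (c : T) : B.rot (inr c) = inl (X.rot (ι c)) := by
  rw [← B.face_rev, h.rev_inr, h.face_inl, X.face_rev]

theorem rot_inl (h : IsCut X t B ι inl inr) {d : D} (hd : d ∉ Set.range ι) :
    B.rot (inl d) = inl (X.rot d) := by
  rw [← B.face_rev, h.rev_inl d hd, h.face_inl, X.face_rev]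

theorem rot_inl_tree (h : IsCut X t B ι inl inr) (c : T) :
    B.rot (inl (ι c)) = inr (t.rot⁻¹ c) := by
  rw [← B.face_rev, h.rev_inl_tree, h.face_inr, RotationSystem.contour, Equiv.Perm.mul_apply,
    t.rev_rev]

theorem inl_notMem (h : IsCut X t B ι inl inr) (d : D) : inl d ∉ Set.range inr := by
  rintro ⟨c, hc⟩
  exact h.inl_ne_inr d c hc.symm

theorem pow_rot_inr (h : IsCut X t B ι inl inr) (c : T) (n : ℕ)
    (hn : ∀ j, 0 < j → j ≤ n → (X.rot ^ j) (ι c) ∉ Set.range ι) :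
    (B.rot ^ (n + 1)) (inr c) = inl ((X.rot ^ (n + 1)) (ι c)) := by
  induction n with
  | zero => simpa using h.rot_inr c
  | succ n ih =>
    rw [pow_succ' _ (n + 1), Equiv.Perm.mul_apply, ih fun j h0 hj => hn j h0 (by omega),
      h.rot_inl (hn _ (by omega) le_rfl), ← Equiv.Perm.mul_apply, ← pow_succ']

/-- The turn from `inr c` shadows the turn from `ι c` in `X`, reaches `inl (ι (t.rot c))` after the
return time of `c`, and one further step leads back to `inr c`. Thus each vertex on the slit carries
a single corner of the tree. -/
theorem isFirstReturn_inr (h : IsCut X t B ι inl inr) (ht : IsFirstReturn X.rot t.rot ι) :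
    IsFirstReturn B.rot 1 inr := by
  intro c
  obtain ⟨k, hk, hkc, hlt⟩ := ht c
  have hpow : ∀ n < k, (B.rot ^ (n + 1)) (inr c) = inl ((X.rot ^ (n + 1)) (ι c)) :=
    fun n hn => h.pow_rot_inr c n fun j h0 hj => hlt j h0 (by omega)
  refine ⟨k + 1, by omega, ?_, fun j h0 hj => ?_⟩
  · obtain ⟨k, rfl⟩ := Nat.exists_eq_add_of_lt hk
    rw [pow_succ', Equiv.Perm.mul_apply, hpow _ (by omega), hkc, h.rot_inl_tree]
    simp
  · obtain ⟨j, rfl⟩ := Nat.exists_eq_add_of_lt h0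
    rw [zero_add, hpow _ (by omega)]
    exact h.inl_notMem _

theorem isFirstReturn_tree (h : IsCut X t B ι inl inr) (hB : IsFirstReturn B.rot 1 inr) :
    IsFirstReturn X.rot t.rot ι := by
  intro c
  obtain ⟨k, hk, hkc, hlt⟩ := hB c
  have hnot : ∀ j, 0 < j → j + 1 < k → (X.rot ^ j) (ι c) ∉ Set.range ι := by
    intro j
    induction j using Nat.strong_induction_on with
    | _ j ih =>
      rintro h0 hj ⟨c', hc'⟩
      obtain ⟨j, rfl⟩ := Nat.exists_eq_add_of_lt h0
      refine hlt (0 + j + 1 + 1) (by omega) hj ⟨t.rot⁻¹ c', ?_⟩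
      rw [pow_succ', Equiv.Perm.mul_apply, h.pow_rot_inr c (0 + j) fun i hi hij =>
        ih i (by omega) hi (by omega), ← hc', h.rot_inl_tree]
  obtain ⟨k, rfl⟩ := Nat.exists_eq_add_of_lt hk
  -- A return time of one is impossible, since the first step from `inr c` lands in the range of
  -- `inl`.
  rcases Nat.eq_zero_or_pos k with rfl | hk0
  · have := h.rot_inr c
    exact absurd (this.symm.trans (by simpa using hkc)) (h.inl_ne_inr _ _)
  obtain ⟨k, rfl⟩ := Nat.exists_eq_add_of_lt hk0
  have hpow := h.pow_rot_inr c k fun i hi hik => hnot i hi (by omega)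
  rw [show 0 + (0 + k + 1) + 1 = k + 1 + 1 by omega, pow_succ', Equiv.Perm.mul_apply, hpow] at hkc
  -- The last step re-enters the range of `inr`, which is possible only from a tree edge;
  -- injectivity of `inr` then identifies that edge as `t.rot c`.
  have hmem : (X.rot ^ (k + 1)) (ι c) ∈ Set.range ι := by
    by_contra hmem
    rw [h.rot_inl hmem] at hkc
    exact h.inl_ne_inr _ _ hkc
  obtain ⟨c', hc'⟩ := hmem
  rw [← hc', h.rot_inl_tree] at hkc
  refine ⟨k + 1, by omega, ?_, fun j h0 hj => hnot j h0 (by omega)⟩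
  rw [← hc']
  congr 1
  exact Equiv.Perm.inv_eq_iff_eq.1 (h.inr_injective hkc)

theorem card_orbits_rev [Finite D] [Finite T] (h : IsCut X t B ι inl inr) :
    Nat.card (Orbits B.rev) = Nat.card (Orbits X.rev) + Nat.card (Orbits t.rev) := by
  have h1 := B.card_eq
  have h2 : Nat.card (D ⊕ T) = Nat.card A := by
    refine Nat.card_congr (Equiv.ofBijective (Sum.elim inl inr) ⟨?_, fun a => ?_⟩)
    · exact h.inl_injective.sumElim h.inr_injective h.inl_ne_inr
    · rcases h.cover a with ⟨d, rfl⟩ | ⟨c, rfl⟩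
      · exact ⟨Sum.inl d, rfl⟩
      · exact ⟨Sum.inr c, rfl⟩
  rw [Nat.card_sum, X.card_eq, t.card_eq] at h2
  omega

/-! ### Euler's relation and connectedness under cutting -/

section Counting

variable [Finite D] [Finite T] [Finite A]

/-- Off the tree the vertices correspond. On it, the vertices of `t` give way to one vertex for each
element of `T`, as the first return to `inr` is the identity. -/
theorem card_orbits_rot (h : IsCut X t B ι inl inr) (ht : IsFirstReturn X.rot t.rot ι) :
    Nat.card (Orbits B.rot) + Nat.card (Orbits t.rot) = Nat.card (Orbits X.rot) + Nat.card T := by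
  have h1 := ht.card_orbits h.injective
  have h2 := (h.isFirstReturn_inr ht).card_orbits h.inr_injective
  rw [card_orbits_one] at h2
  have h3 := card_avoidingOrbits_congr (p := X.rot) (p' := B.rot) (S := Set.range ι)
    (S' := Set.range inr) h.inl_injective h.inl_notMem
    (fun x hx => (h.cover x).resolve_right hx)
    (by rintro _ ⟨c, rfl⟩; exact ⟨_, (h.rot_inl_tree c).symm⟩) (fun d hd => h.rot_inl hd)
  omega

theorem card_orbits_face (h : IsCut X t B ι inl inr) (ht : Nat.card (Orbits t.face) = 1) :
    Nat.card (Orbits B.face) = Nat.card (Orbits X.face) + 1 := by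
  have h1 : IsFirstReturn B.face t.contour inr := fun c =>
    ⟨1, one_pos, by simpa using h.face_inr c, fun j h0 hj => by omega⟩
  have h2 := h1.card_orbits h.inr_injective
  have h3 := card_avoidingOrbits_congr (p := X.face) (p' := B.face) (S := ∅)
    (S' := Set.range inr) h.inl_injective h.inl_notMem
    (fun x hx => (h.cover x).resolve_right hx) (by simp) (fun d _ => h.face_inl d)
  rw [card_avoidingOrbits_empty] at h3
  have h4 : Nat.card (Orbits t.contour) = 1 := by
    rw [Nat.card_eq_one_iff_unique]
    obtain ⟨_, ⟨o⟩⟩ := Nat.card_eq_one_iff_unique.1 ht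
    refine ⟨⟨fun a b => ?_⟩, ⟨Quotient.mk _ o.out⟩⟩
    induction a using Quotient.inductionOn
    induction b using Quotient.inductionOn
    exact Quotient.sound (t.sameCycle_contour ht _ _)
  omega

theorem isSpherical_iff (h : IsCut X t B ι inl inr) (ht : IsFirstReturn X.rot t.rot ι)
    (ht' : Nat.card (Orbits t.face) = 1) (hs : t.IsSpherical) :
    B.IsSpherical ↔ X.IsSpherical := by
  have h1 := h.card_orbits_rot ht
  have h2 := h.card_orbits_face ht'
  have h3 := h.card_orbits_rev
  have h4 := t.card_eq
  unfold RotationSystem.IsSpherical at *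
  omega

theorem isConnected (h : IsCut X t B ι inl inr) (ht : Nat.card (Orbits t.face) = 1)
    (hX : X.IsConnected) : B.IsConnected := by
  rw [RotationSystem.isConnected_iff] at hX ⊢
  intro P hrev hface
  have htree : ∀ c c', P (inr c) → P (inr c') := fun c c' =>
    apply_of_apply_perm (P := fun c => P (inr c))
      (fun d hd => by rw [← h.face_inr]; exact hface _ hd) (t.sameCycle_contour ht c c')
  have hinl : ∀ d d', P (inl d) → P (inl d') := by
    refine hX (fun d => P (inl d)) (fun d hd => ?_) fun d hd => ?_
    · by_cases hdt : d ∈ Set.range ι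
      · obtain ⟨c, rfl⟩ := hdt
        -- The slit is crossed by walking around the new face, from `inr (t.rev c)` to `inr c`.
        rw [← h.rev_inr]
        refine hrev _ (htree (t.rev c) c ?_)
        rw [← h.rev_inl_tree]
        exact hrev _ hd
      · rw [← h.rev_inl d hdt]
        exact hrev _ hd
    · rw [← h.face_inl]
      exact hface _ hd
  have hto : ∀ a, P a → ∃ d, P (inl d) := by
    intro a ha
    rcases h.cover a with ⟨d, rfl⟩ | ⟨c, rfl⟩
    · exact ⟨d, ha⟩
    · exact ⟨_, h.rev_inr c ▸ hrev _ ha⟩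
  intro a a' ha
  obtain ⟨d, hd⟩ := hto a ha
  rcases h.cover a' with ⟨d', rfl⟩ | ⟨c, rfl⟩
  · exact hinl _ _ hd
  · rw [← t.rev_rev c, ← h.rev_inl_tree]
    exact hrev _ (hinl _ _ hd)

theorem isConnected_of_cut (h : IsCut X t B ι inl inr) (ht : IsFirstReturn X.rot t.rot ι)
    (hB : B.IsConnected) : X.IsConnected := by
  rw [RotationSystem.isConnected_iff] at hB ⊢
  intro P hrev hface d d' hd
  have hrot : ∀ d, P d → P (X.rot d) := fun d hd => X.face_rev d ▸ hface _ (hrev _ hd)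
  have htree : ∀ c c', t.rot.SameCycle c c' → P (ι c) → P (ι c') := fun c c' hc =>
    apply_of_apply_perm hrot ((ht.sameCycle_iff h.injective).2 hc)
  -- `P'` is the pullback of `P` under the folding map that sends `inl d` to `d` and `inr c` to `ι
  -- c`.
  let P' : A → Prop := fun a => ∃ d, P d ∧ (inl d = a ∨ ∃ c, ι c = d ∧ inr c = a)
  have hP' : ∀ d, P' (inl d) → P d := by
    rintro d ⟨d', hd', hdd | ⟨c, rfl, hc⟩⟩
    · exact h.inl_injective hdd ▸ hd'
    · exact absurd hc.symm (h.inl_ne_inr _ _)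
  refine hP' d' (hB P' ?_ ?_ (inl d) (inl d') ⟨d, hd, Or.inl rfl⟩)
  · rintro _ ⟨d, hd, rfl | ⟨c, rfl, rfl⟩⟩
    · by_cases hdt : d ∈ Set.range ι
      · obtain ⟨c, rfl⟩ := hdt
        exact ⟨_, hrev _ hd, Or.inr ⟨t.rev c, h.map_rev c, (h.rev_inl_tree c).symm⟩⟩
      · exact ⟨_, hrev _ hd, Or.inl (h.rev_inl d hdt).symm⟩
    · exact ⟨_, hrev _ hd, Or.inl (h.rev_inr c).symm⟩
  · rintro _ ⟨d, hd, rfl | ⟨c, rfl, rfl⟩⟩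
    · exact ⟨_, hface _ hd, Or.inl (h.face_inl d).symm⟩
    -- A step along the new face is a reversal followed by a turn in `t`; such a turn stays at one
    -- vertex of `X`, because `t.rot` is a first return map of `X.rot`.
    · refine ⟨ι (t.contour c), htree (t.rev c) _ ?_ (h.map_rev c ▸ hrev _ hd),
        Or.inr ⟨_, rfl, (h.face_inr c).symm⟩⟩
      exact ⟨-1, by rw [zpow_neg_one]; rfl⟩

end Counting

/-- A rotation system has, up to isomorphism, only one cut along a given subsystem. -/
theorem exists_equiv {A' : Type} {B' : RotationSystem A'} {inl' : D → A'} {inr' : T → A'}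
    (h : IsCut X t B ι inl inr) (h' : IsCut X t B' ι inl' inr') :
    ∃ φ : A ≃ A', (∀ a, φ (B.rev a) = B'.rev (φ a)) ∧ (∀ a, φ (B.rot a) = B'.rot (φ a)) ∧
      ∀ c, φ (inr c) = inr' c := by
  have bij : ∀ {A : Type} {B : RotationSystem A} {inl : D → A} {inr : T → A},
      IsCut X t B ι inl inr → Function.Bijective (Sum.elim inl inr) := by
    intro A B inl inr h
    refine ⟨h.inl_injective.sumElim h.inr_injective h.inl_ne_inr, fun a => ?_⟩
    rcases h.cover a with ⟨d, rfl⟩ | ⟨c, rfl⟩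
    · exact ⟨Sum.inl d, rfl⟩
    · exact ⟨Sum.inr c, rfl⟩
  let e := Equiv.ofBijective _ (bij h)
  let e' := Equiv.ofBijective _ (bij h')
  have hl : ∀ d, (e.symm.trans e') (inl d) = inl' d := fun d => by
    rw [Equiv.trans_apply, (Equiv.symm_apply_eq e).2 (show inl d = e (Sum.inl d) from rfl)]; rfl
  have hr : ∀ c, (e.symm.trans e') (inr c) = inr' c := fun c => by
    rw [Equiv.trans_apply, (Equiv.symm_apply_eq e).2 (show inr c = e (Sum.inr c) from rfl)]; rfl
  refine ⟨e.symm.trans e', fun a => ?_, fun a => ?_, hr⟩ <;>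
    rcases h.cover a with ⟨d, rfl⟩ | ⟨c, rfl⟩
  · by_cases hd : d ∈ Set.range ι
    · obtain ⟨c, rfl⟩ := hd
      rw [h.rev_inl_tree, hr, hl, h'.rev_inl_tree]
    · rw [h.rev_inl d hd, hl, hl, h'.rev_inl d hd]
  · rw [h.rev_inr, hl, hr, h'.rev_inr]
  · by_cases hd : d ∈ Set.range ι
    · obtain ⟨c, rfl⟩ := hd
      rw [h.rot_inl_tree, hr, hl, h'.rot_inl_tree]
    · rw [h.rot_inl hd, hl, hl, h'.rot_inl hd]
  · rw [h.rot_inr, hl, hr, h'.rot_inr]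

end IsCut

/-! ### Transport along isomorphisms -/

theorem IsFirstReturn.map {α α' β β' : Type} {p : Equiv.Perm α} {q : Equiv.Perm β} {ι : β → α}
    (h : IsFirstReturn p q ι) {p' : Equiv.Perm α'} {q' : Equiv.Perm β'} (φ : α ≃ α') (ψ : β ≃ β')
    (hφ : ∀ a, φ (p a) = p' (φ a)) (hψ : ∀ b, ψ (q b) = q' (ψ b)) :
    IsFirstReturn p' q' (φ ∘ ι ∘ ψ.symm) := by
  have hpow : ∀ (n : ℕ) a, (p' ^ n) (φ a) = φ ((p ^ n) a) := by
    intro n a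
    induction n with
    | zero => rfl
    | succ n ih => rw [pow_succ', pow_succ', Equiv.Perm.mul_apply, Equiv.Perm.mul_apply, ih, hφ]
  intro b
  obtain ⟨b, rfl⟩ := ψ.surjective b
  obtain ⟨k, hk, hkb, hlt⟩ := h b
  refine ⟨k, hk, ?_, ?_⟩
  · simp [hpow, hkb, ← hψ]
  · rintro j h0 hj ⟨c, hc⟩
    refine hlt j h0 hj ⟨ψ.symm c, φ.injective ?_⟩
    rw [← hpow]
    simpa using hc

theorem IsCut.map {D D' T T' A A' : Type} {X : RotationSystem D} {t : RotationSystem T}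
    {B : RotationSystem A} {ι : T → D} {inl : D → A} {inr : T → A} (h : IsCut X t B ι inl inr)
    {X' : RotationSystem D'} {t' : RotationSystem T'} {B' : RotationSystem A'}
    (φ : D ≃ D') (ψ : T ≃ T') (χ : A ≃ A')
    (hφ : (∀ d, φ (X.rev d) = X'.rev (φ d)) ∧ ∀ d, φ (X.rot d) = X'.rot (φ d))
    (hψ : (∀ d, ψ (t.rev d) = t'.rev (ψ d)) ∧ ∀ d, ψ (t.rot d) = t'.rot (ψ d))
    (hχ : (∀ d, χ (B.rev d) = B'.rev (χ d)) ∧ ∀ d, χ (B.rot d) = B'.rot (χ d)) :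
    IsCut X' t' B' (φ ∘ ι ∘ ψ.symm) (χ ∘ inl ∘ φ.symm) (χ ∘ inr ∘ ψ.symm) where
  injective := φ.injective.comp (h.injective.comp ψ.symm.injective)
  map_rev c := by
    obtain ⟨c, rfl⟩ := ψ.surjective c
    simp [← hψ.1, ← hφ.1, h.map_rev]
  inl_injective := χ.injective.comp (h.inl_injective.comp φ.symm.injective)
  inr_injective := χ.injective.comp (h.inr_injective.comp ψ.symm.injective)
  inl_ne_inr d c hdc := h.inl_ne_inr _ _ (χ.injective hdc)
  cover a := by
    obtain ⟨a, rfl⟩ := χ.surjective a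
    rcases h.cover a with ⟨d, rfl⟩ | ⟨c, rfl⟩
    · exact Or.inl ⟨φ d, by simp⟩
    · exact Or.inr ⟨ψ c, by simp⟩
  rev_inr c := by
    obtain ⟨c, rfl⟩ := ψ.surjective c
    simp [← hχ.1, ← hφ.1, h.rev_inr]
  rev_inl d hd := by
    obtain ⟨d, rfl⟩ := φ.surjective d
    have : d ∉ Set.range ι := fun ⟨c, hc⟩ => hd ⟨ψ c, by simp [hc]⟩
    simp [← hχ.1, ← hφ.1, h.rev_inl d this]
  face_inl d := by
    obtain ⟨d, rfl⟩ := φ.surjective d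
    have h1 : ∀ a, χ (B.face a) = B'.face (χ a) := fun a => (hχ.2 _).trans (by rw [hχ.1]; rfl)
    have h2 : ∀ a, φ (X.face a) = X'.face (φ a) := fun a => (hφ.2 _).trans (by rw [hφ.1]; rfl)
    simp [← h1, ← h2, h.face_inl]
  face_inr c := by
    obtain ⟨c, rfl⟩ := ψ.surjective c
    have h1 : ∀ a, χ (B.face a) = B'.face (χ a) := fun a => (hχ.2 _).trans (by rw [hχ.1]; rfl)
    have h2 : ∀ a, ψ (t.contour a) = t'.contour (ψ a) := fun a => by
      refine Eq.symm (Equiv.Perm.inv_eq_iff_eq.2 ?_)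
      rw [← hψ.2, ← hψ.1, RotationSystem.contour]
      simp
    simp [← h1, ← h2, h.face_inr]

/-! ### Boundary and edge counts of the cut map -/

namespace RootedMap

attribute [instance] finite_dart

def rotationSystem (M : RootedMap) : RotationSystem M.Dart :=
  ⟨M.rev, M.rot, M.rev_rev, M.rev_ne⟩

theorem card_dart (M : RootedMap) : Nat.card M.Dart = 2 * M.numEdges :=
  M.rotationSystem.card_eq

theorem IsTree.sameCycle_contour {t : RootedMap} (ht : t.IsTree) (c c' : t.Dart) :
    t.contour.SameCycle c c' :=
  t.rotationSystem.sameCycle_contour ht c c'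

theorem face_mem_boundary_iff {M : RootedMap} {d : M.Dart} :
    M.face d ∈ M.boundary ↔ d ∈ M.boundary :=
  Equiv.Perm.sameCycle_apply_right

/-- No edge lies on the boundary with both orientations, so boundary edges and oriented boundary
edges are equally many. -/
theorem HasSimpleBoundary.numEdges_eq {M : RootedMap} (h : M.HasSimpleBoundary) :
    M.numEdges = Nat.card M.boundary + M.numInteriorEdges := by
  have h1 : IsFirstReturn M.rev 1 (Subtype.val : M.boundary → M.Dart) := by
    refine isFirstReturn_one fun c c' hc => ?_
    rcases (sameCycle_involution_iff M.rev_rev).1 hc with hc | hc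
    · exact hc.symm
    · exact absurd (hc ▸ c'.2) (h.2 c c.2)
  have h2 := h1.card_orbits Subtype.val_injective
  rw [card_orbits_one, Subtype.range_coe] at h2
  exact h2

/-- The rooted map `B` is obtained by cutting `X` open along the image of `t` under `ι`. -/
def IsCutMap (X t B : RootedMap) (ι : t.Dart → X.Dart) (inl : X.Dart → B.Dart)
    (inr : t.Dart → B.Dart) : Prop :=
  IsCut X.rotationSystem t.rotationSystem B.rotationSystem ι inl inr ∧ inr t.root = B.root

namespace IsCutMap

variable {X t B : RootedMap} {ι : t.Dart → X.Dart} {inl : X.Dart → B.Dart} {inr : t.Dart → B.Dart}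

theorem face_pow_root (h : IsCutMap X t B ι inl inr) (n : ℕ) :
    (B.face ^ n) B.root = inr ((t.contour ^ n) t.root) := by
  induction n with
  | zero => exact h.2.symm
  | succ n ih =>
    rw [pow_succ', pow_succ', Equiv.Perm.mul_apply, Equiv.Perm.mul_apply, ih]
    exact h.1.face_inr _

theorem boundary_eq (h : IsCutMap X t B ι inl inr) (ht : t.IsTree) :
    B.boundary = Set.range inr := by
  ext a
  constructor
  · intro ha
    obtain ⟨n, rfl⟩ := exists_pow_eq_of_sameCycle ha
    exact ⟨_, (h.face_pow_root n).symm⟩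
  · rintro ⟨c, rfl⟩
    obtain ⟨n, rfl⟩ := exists_pow_eq_of_sameCycle (ht.sameCycle_contour t.root c)
    exact sameCycle_of_pow_eq (h.face_pow_root n)

theorem card_boundary (h : IsCutMap X t B ι inl inr) (ht : t.IsTree) :
    Nat.card B.boundary = 2 * t.numEdges := by
  rw [h.boundary_eq ht, ← card_dart]
  exact Nat.card_range_of_injective h.1.inr_injective

theorem hasSimpleBoundary (h : IsCutMap X t B ι inl inr) (ht : t.IsTree)
    (hsub : IsSubmap t X ι) : B.HasSimpleBoundary := by
  unfold HasSimpleBoundary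
  rw [h.boundary_eq ht]
  refine ⟨?_, ?_⟩
  · rintro _ ⟨c, rfl⟩ _ ⟨c', rfl⟩ hc
    have h1 := h.1.isFirstReturn_inr hsub.2.2
    rw [Equiv.Perm.sameCycle_one.1 ((h1.sameCycle_iff h.1.inr_injective).1 hc)]
  · rintro _ ⟨c, rfl⟩ hc
    exact h.1.inl_notMem _ (h.1.rev_inr c ▸ hc)

theorem numEdges_eq (h : IsCutMap X t B ι inl inr) : B.numEdges = X.numEdges + t.numEdges :=
  h.1.card_orbits_rev

theorem numInteriorEdges_add (h : IsCutMap X t B ι inl inr) (ht : t.IsTree)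
    (hB : B.HasSimpleBoundary) : B.numInteriorEdges + t.numEdges = X.numEdges := by
  have h1 := hB.numEdges_eq
  have h2 := h.card_boundary ht
  have h3 := h.numEdges_eq
  omega

end IsCutMap

theorem IsIso.commutes {M N : RootedMap} {φ : M.Dart ≃ N.Dart} (h : IsIso M N φ) :
    (∀ d, φ (M.rotationSystem.rev d) = N.rotationSystem.rev (φ d)) ∧
      ∀ d, φ (M.rotationSystem.rot d) = N.rotationSystem.rot (φ d) :=
  ⟨h.1, h.2.1⟩

theorem IsRootedSubtree.map {t X t' X' : RootedMap} {S : Set X.Dart} {ι : t.Dart → X.Dart}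
    (h : IsRootedSubtree t X S ι) (ht' : t'.IsTree) {φ : X.Dart ≃ X'.Dart} {ψ : t.Dart ≃ t'.Dart}
    (hφ : IsIso X X' φ) (hψ : IsIso t t' ψ) :
    IsRootedSubtree t' X' (φ '' S) (φ ∘ ι ∘ ψ.symm) := by
  obtain ⟨-, ⟨h1, h2, h3⟩, h4, rfl⟩ := h
  refine ⟨ht', ⟨φ.injective.comp (h1.comp ψ.symm.injective), fun c => ?_,
    IsFirstReturn.map h3 φ ψ hφ.2.1 hψ.2.1⟩, ?_, ?_⟩
  · obtain ⟨c, rfl⟩ := ψ.surjective c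
    simp [← hψ.1, ← hφ.1, h2]
  · simp [← hψ.2.2, ← hφ.2.2, h4]
  · rw [Set.range_comp, ψ.symm.surjective.range_comp]

/-- Two plane trees exhibited as the same submap are isomorphic. -/
theorem IsRootedSubtree.exists_isIso {t t' X : RootedMap} {S : Set X.Dart} {ι : t.Dart → X.Dart}
    {ι' : t'.Dart → X.Dart} (h : IsRootedSubtree t X S ι) (h' : IsRootedSubtree t' X S ι') :
    ∃ ψ : t'.Dart ≃ t.Dart, IsIso t' t ψ ∧ ι' ∘ ψ.symm = ι := by
  obtain ⟨-, ⟨h1, h2, h3⟩, h4, h5⟩ := h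
  obtain ⟨-, ⟨h1', h2', h3'⟩, h4', h5'⟩ := h'
  have hex : ∀ c, ∃ c', ι c' = ι' c := fun c => by
    have : ι' c ∈ Set.range ι := by rw [h5, ← h5']; exact ⟨c, rfl⟩
    exact this
  choose ψ hψ using hex
  have hbij : Function.Bijective ψ := by
    refine ⟨fun a b hab => h1' ?_, fun c => ?_⟩
    · rw [← hψ, ← hψ, hab]
    · obtain ⟨c', hc'⟩ : ι c ∈ Set.range ι' := by rw [h5', ← h5]; exact ⟨c, rfl⟩
      exact ⟨c', h1 (by rw [hψ, hc'])⟩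
  let e := Equiv.ofBijective ψ hbij
  have he : ∀ c, ι (e c) = ι' c := hψ
  have hfr : IsFirstReturn X.rot ((e.symm.trans t'.rot).trans e) ι := by
    have := IsFirstReturn.map (q' := (e.symm.trans t'.rot).trans e) h3' (Equiv.refl X.Dart) e
      (p' := X.rot) (fun _ => rfl) (fun b => by simp)
    convert this using 1
    funext c
    simp [← he]
  have huniq : t.rot = (e.symm.trans t'.rot).trans e := IsFirstReturn.unique h1 h3 hfr
  refine ⟨e, ⟨fun c => h1 ?_, fun c => ?_, h1 ?_⟩, ?_⟩
  · rw [he, h2, h2', he]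
  · rw [huniq]; simp
  · rw [he, h4, h4']
  · funext c
    simp [← he]

end RootedMap

/-! ### Gluings as cuts, and their uniqueness -/

open RootedMap in
theorem IsGluing.exists_isCutMap {e m : ℕ} {t : TreeRep m} {B : BoundaryMapRep e m}
    {X : DecoratedMapRep e m} (h : IsGluing t B X) :
    ∃ ι inl inr, IsRootedSubtree t.map X.map X.tree ι ∧ IsCutMap X.map t.map B.map ι inl inr := by
  obtain ⟨ι, f, hι, hrev, hbdry, hbij, hface⟩ := h
  -- The boundary and the contour are cycles of the same length `2 * m`, so matching their roots
  -- labels the boundary by the oriented edges of `t`.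
  obtain ⟨inr, hinj, hrange, hroot, hcomm⟩ := exists_orbit_labelling (p := B.map.face)
    (q := t.map.contour) B.map.root t.map.root (t.isTree.sameCycle_contour _)
    (B.boundary_size.trans (by rw [card_dart, t.numEdges_eq]))
  change Set.range inr = B.map.boundary at hrange
  have hpow : ∀ n : ℕ, inr ((t.map.contour ^ n) t.map.root) = (B.map.face ^ n) B.map.root := by
    intro n
    induction n with
    | zero => exact hroot
    | succ n ih =>
      rw [pow_succ', pow_succ', Equiv.Perm.mul_apply, Equiv.Perm.mul_apply, hcomm, ih]
  have hf : ∀ c, f (inr c) = ι c := fun c => by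
    obtain ⟨n, rfl⟩ := exists_pow_eq_of_sameCycle (t.isTree.sameCycle_contour t.map.root c)
    rw [hpow, hbdry]
  have hmem : ∀ c, inr c ∈ B.map.boundary := fun c => hrange ▸ ⟨c, rfl⟩
  -- `inl` is the inverse of `f` off the boundary; each identity for `inl` below follows from
  -- uniqueness of the preimage there.
  choose inl hinl hfinl using fun x => hbij.surjOn (Set.mem_univ x)
  have hinl' : ∀ d ∉ B.map.boundary, ∀ x, f d = x → d = inl x := fun d hd x hx =>
    hbij.injOn hd (hinl x) (hx.trans (hfinl x).symm)
  refine ⟨ι, inl, inr, hι, ?_, hroot⟩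
  exact {
    injective := hι.2.1.1
    map_rev := hι.2.1.2.1
    inl_injective := fun x y hxy => by rw [← hfinl x, ← hfinl y, hxy]
    inr_injective := hinj
    inl_ne_inr := fun x c hxc => hinl x (hxc ▸ hmem c)
    cover := fun a => by
      by_cases ha : a ∈ B.map.boundary
      · rw [← hrange] at ha
        exact Or.inr ha
      · exact Or.inl ⟨f a, (hinl' a ha _ rfl).symm⟩
    rev_inr := fun c => hinl' _ (B.simple.2 _ (hmem c)) _ (by rw [hrev, hf]; rfl)
    rev_inl := fun d hd => by
      refine hinl' _ (fun hb => ?_) _ (by erw [hrev, hfinl]; rfl)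
      rw [← hrange] at hb
      obtain ⟨c, hc⟩ := hb
      refine hd ⟨t.map.rev c, ?_⟩
      rw [hι.2.1.2.1, ← hf, hc]
      erw [hrev]
      rw [X.map.rev_rev, hfinl]
    face_inl := fun d => by
      refine hinl' _ (fun hb => hinl d (face_mem_boundary_iff.1 hb)) _ ?_
      exact (hface _ (hinl d)).trans (by rw [hfinl]; rfl)
    face_inr := fun c => (hcomm c).symm }

open RootedMap in
theorem isGluing_of_isCutMap {e m : ℕ} {t : TreeRep m} {B : BoundaryMapRep e m}
    {X : DecoratedMapRep e m} {ι : t.map.Dart → X.map.Dart} {inl : X.map.Dart → B.map.Dart}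
    {inr : t.map.Dart → B.map.Dart} (hι : IsRootedSubtree t.map X.map X.tree ι)
    (h : IsCutMap X.map t.map B.map ι inl inr) : IsGluing t B X := by
  -- The gluing map `f` undoes the cut: it folds `inr c` onto `ι c`.
  have hex : ∀ a, ∃ x, (∀ d, inl d = a → x = d) ∧ ∀ c, inr c = a → x = ι c := by
    intro a
    rcases h.1.cover a with ⟨d, rfl⟩ | ⟨c, rfl⟩
    · exact ⟨d, fun d' hd => (h.1.inl_injective hd).symm,
        fun c hc => absurd hc.symm (h.1.inl_ne_inr _ _)⟩
    · exact ⟨ι c, fun d hd => absurd hd (h.1.inl_ne_inr _ _),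
        fun c' hc => by rw [h.1.inr_injective hc]⟩
  choose f hfl hfr using hex
  replace hfl : ∀ d, f (inl d) = d := fun d => hfl _ d rfl
  replace hfr : ∀ c, f (inr c) = ι c := fun c => hfr _ c rfl
  have hnot : ∀ d ∉ B.map.boundary, ∃ x, inl x = d := fun d hd =>
    (h.1.cover d).resolve_right (by rwa [h.boundary_eq t.isTree] at hd)
  refine ⟨ι, f, hι, fun a => ?_, fun i => ?_, ⟨Set.mapsTo_univ _ _, fun a ha b hb hab => ?_,
    fun x _ => ⟨inl x, ?_, hfl x⟩⟩, fun a ha => ?_⟩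
  · rcases h.1.cover a with ⟨d, rfl⟩ | ⟨c, rfl⟩
    · by_cases hd : d ∈ Set.range ι
      · obtain ⟨c, rfl⟩ := hd
        have := h.1.rev_inl_tree c
        change B.map.rev _ = _ at this
        rw [this, hfr, hfl]
        exact hι.2.1.2.1 c
      · have := h.1.rev_inl d hd
        change B.map.rev _ = _ at this
        rw [this, hfl, hfl]
        rfl
    · have := h.1.rev_inr c
      change B.map.rev _ = _ at this
      rw [this, hfl, hfr]
      rfl
  · rw [h.face_pow_root, hfr]
  · obtain ⟨x, rfl⟩ := hnot a ha
    obtain ⟨y, rfl⟩ := hnot b hb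
    rw [← hfl x, hab, hfl]
  · rw [h.boundary_eq t.isTree]
    exact h.1.inl_notMem x
  · obtain ⟨x, rfl⟩ := hnot a ha
    have := h.1.face_inl x
    change B.map.face _ = _ at this
    rw [this, hfl, hfl]
    rfl

open RootedMap in
theorem IsGluing.congr {e m : ℕ} {t t' : TreeRep m} {B B' : BoundaryMapRep e m}
    {X X' : DecoratedMapRep e m} (h : IsGluing t B X) (ht : t ≈ t') (hB : B ≈ B') (hX : X ≈ X') :
    IsGluing t' B' X' := by
  obtain ⟨ι, inl, inr, hι, hcut, hroot⟩ := h.exists_isCutMap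
  obtain ⟨ψ, hψ⟩ := ht
  obtain ⟨χ, hχ⟩ := hB
  obtain ⟨φ, hφ, htree⟩ := hX
  refine isGluing_of_isCutMap (ι := φ ∘ ι ∘ ψ.symm) (inl := χ ∘ inl ∘ φ.symm)
    (inr := χ ∘ inr ∘ ψ.symm) (htree ▸ hι.map t'.isTree hφ hψ)
    ⟨hcut.map φ ψ χ hφ.commutes hψ.commutes hχ.commutes, ?_⟩
  simp [← hψ.2.2, ← hχ.2.2, hroot]

open RootedMap in
-- Both trees are the same submap of `X`, hence isomorphic over it. After transport along this
-- isomorphism, both boundary maps are cuts along one embedded tree, and such a cut is unique.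
theorem IsGluing.tree_equiv_and_boundaryMap_equiv {e m : ℕ} {t t' : TreeRep m}
    {B B' : BoundaryMapRep e m} {X : DecoratedMapRep e m} (h : IsGluing t B X)
    (h' : IsGluing t' B' X) : t ≈ t' ∧ B ≈ B' := by
  obtain ⟨ι, inl, inr, hι, hcut, hroot⟩ := h.exists_isCutMap
  obtain ⟨ι', inl', inr', hι', hcut', hroot'⟩ := h'.exists_isCutMap
  obtain ⟨ψ, hψ, rfl⟩ := hι.exists_isIso hι'
  have hcut'' := hcut'.map (Equiv.refl _) ψ (Equiv.refl _) (IsIso.refl _).commutes hψ.commutes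
    (IsIso.refl _).commutes
  obtain ⟨χ, h1, h2, h3⟩ := hcut.exists_equiv hcut''
  refine ⟨⟨_, hψ.symm⟩, χ, h1, h2, ?_⟩
  rw [← hroot, h3, ← hroot']
  simp [← hψ.2.2]

open RootedMap in
theorem IsGluing.decoratedMap_equiv {e m : ℕ} {t : TreeRep m} {B : BoundaryMapRep e m}
    {X X' : DecoratedMapRep e m} (h : IsGluing t B X) (h' : IsGluing t B X') : X ≈ X' := by
  obtain ⟨ι, f, hι, hrev, hbdry, hbij, hface⟩ := h
  obtain ⟨ι', f', hι', hrev', hbdry', hbij', hface'⟩ := h'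
  choose g hg hfg using fun x => hbij.surjOn (Set.mem_univ x)
  have hgf : ∀ d ∉ B.map.boundary, g (f d) = d := fun d hd => hbij.injOn (hg _) hd (hfg _)
  have hφbij : Function.Bijective (f' ∘ g) := by
    refine ⟨fun x y hxy => ?_, fun y => ?_⟩
    · rw [← hfg x, ← hfg y, hbij'.injOn (hg x) (hg y) hxy]
    · obtain ⟨d, hd, rfl⟩ := hbij'.surjOn (Set.mem_univ y)
      exact ⟨f d, congrArg f' (hgf d hd)⟩
  -- Each glued map has the non-boundary oriented edges of `B` as its own, so `φ` matches them by
  -- going back to `B`.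
  let φ := Equiv.ofBijective _ hφbij
  have hφ : ∀ d ∉ B.map.boundary, φ (f d) = f' d := fun d hd => congrArg f' (hgf d hd)
  have hφι : ∀ c, φ (ι c) = ι' c := by
    intro c
    -- So far `φ` is known only on images of non-boundary edges. The edge `ι c` is such an image: it
    -- comes from the reverse of the boundary edge labelled `t.map.rev c`.
    obtain ⟨n, hn⟩ := exists_pow_eq_of_sameCycle
      (t.isTree.sameCycle_contour t.map.root (t.map.rev c))
    have h1 : f (B.map.rev ((B.map.face ^ n) B.map.root)) = ι c := by
      rw [hrev, hbdry, hn, ← hι.2.1.2.1, t.map.rev_rev]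
    have h2 : f' (B.map.rev ((B.map.face ^ n) B.map.root)) = ι' c := by
      rw [hrev', hbdry', hn, ← hι'.2.1.2.1, t.map.rev_rev]
    rw [← h1, ← h2]
    exact hφ _ (B.simple.2 _ (sameCycle_of_pow_eq rfl))
  have hφ' : ∀ d, φ (f d) = f' d := by
    intro d
    by_cases hd : d ∈ B.map.boundary
    · obtain ⟨n, rfl⟩ := exists_pow_eq_of_sameCycle hd
      rw [hbdry, hbdry', hφι]
    · exact hφ d hd
  have hφrev : ∀ x, φ (X.map.rev x) = X'.map.rev (φ x) := fun x => by
    rw [← hfg x, ← hrev, hφ', hφ', hrev']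
  have hφface : ∀ x, φ (X.map.face x) = X'.map.face (φ x) := fun x => by
    rw [← hfg x, ← hface _ (hg x), hφ', hφ', hface' _ (hg x)]
  refine ⟨φ, ⟨hφrev, fun x => ?_, ?_⟩, ?_⟩
  · have := hφface (X.map.rev x)
    rw [hφrev] at this
    simpa [RootedMap.face, X.map.rev_rev, X'.map.rev_rev] using this
  · rw [← hι.2.2.1, hφι, hι'.2.2.1]
  · rw [← hι.2.2.2, ← hι'.2.2.2, ← Set.range_comp]
    exact congrArg Set.range (funext hφι)

/-! ### Existence of the cut and of the gluing -/

open RootedMap in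
theorem DecoratedMapRep.exists_isGluing {e m : ℕ} (X : DecoratedMapRep e m) :
    ∃ (t : TreeRep m) (B : BoundaryMapRep e m), IsGluing t B X := by
  classical
  obtain ⟨t, htm, ι, hι⟩ := X.isTree
  obtain ⟨ht, ⟨hinj, hrev, hrot⟩, hroot, hrange⟩ := hι
  -- Slitting a tree edge: each of its two orientations keeps the face on its left and receives a
  -- new reverse, which borders the slit.
  let ρ : X.map.Dart ⊕ t.Dart → X.map.Dart ⊕ t.Dart := Sum.elim
    (fun d => if h : ∃ c, ι c = d then Sum.inr (t.rev h.choose) else Sum.inl (X.map.rev d))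
    (fun c => Sum.inl (X.map.rev (ι c)))
  have hρr : ∀ c, ρ (Sum.inr c) = Sum.inl (X.map.rev (ι c)) := fun _ => rfl
  have hρt : ∀ c, ρ (Sum.inl (ι c)) = Sum.inr (t.rev c) := fun c => by
    have h : ∃ c', ι c' = ι c := ⟨c, rfl⟩
    refine (dif_pos h).trans ?_
    rw [hinj h.choose_spec]
  have hρl : ∀ d ∉ Set.range ι, ρ (Sum.inl d) = Sum.inl (X.map.rev d) := fun d hd => dif_neg hd
  have hrevmem : ∀ d ∉ Set.range ι, X.map.rev d ∉ Set.range ι := by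
    rintro d hd ⟨c, hc⟩
    exact hd ⟨t.rev c, by rw [hrev, hc, X.map.rev_rev]⟩
  have hρρ : Function.Involutive ρ := by
    rintro (d | c)
    · by_cases hd : d ∈ Set.range ι
      · obtain ⟨c, rfl⟩ := hd
        rw [hρt, hρr, hrev, X.map.rev_rev]
      · rw [hρl d hd, hρl _ (hrevmem d hd), X.map.rev_rev]
    · rw [hρr, ← hrev, hρt, t.rev_rev]
  have hρne : ∀ a, ρ a ≠ a := by
    rintro (d | c)
    · by_cases hd : d ∈ Set.range ι
      · obtain ⟨c, rfl⟩ := hd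
        rw [hρt]
        exact Sum.inr_ne_inl
      · rw [hρl d hd]
        exact fun h => X.map.rev_ne d (Sum.inl_injective h)
    · exact Sum.inl_ne_inr
  let S : RotationSystem (X.map.Dart ⊕ t.Dart) :=
    -- The rotation is forced by the prescribed face permutation, as face composed with reversal.
    ⟨hρρ.toPerm, Equiv.sumCongr X.map.face t.contour * hρρ.toPerm, hρρ, hρne⟩
  have hface : S.face = Equiv.sumCongr X.map.face t.contour := by
    have : hρρ.toPerm * hρρ.toPerm = 1 := Equiv.ext hρρ
    change Equiv.sumCongr X.map.face t.contour * hρρ.toPerm * hρρ.toPerm = _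
    rw [mul_assoc, this, mul_one]
  have hcut : IsCut X.map.rotationSystem t.rotationSystem S ι Sum.inl Sum.inr := {
    injective := hinj
    map_rev := hrev
    inl_injective := Sum.inl_injective
    inr_injective := Sum.inr_injective
    inl_ne_inr := fun _ _ => Sum.inl_ne_inr
    cover := by rintro (d | c) <;> simp
    rev_inr := hρr
    rev_inl := hρl
    face_inl := fun d => by rw [hface]; rfl
    face_inr := fun c => by rw [hface]; rfl }
  let B : RootedMap := {
    Dart := X.map.Dart ⊕ t.Dart
    finite_dart := inferInstance
    rev := S.rev
    rot := S.rot
    root := Sum.inr t.root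
    rev_rev := S.rev_rev
    rev_ne := S.rev_ne
    connected := hcut.isConnected ht X.map.connected
    euler := (hcut.isSpherical_iff hrot ht t.euler).2 X.map.euler }
  have hB : IsCutMap X.map t B ι Sum.inl Sum.inr := ⟨hcut, rfl⟩
  have hsimple := hB.hasSimpleBoundary ht ⟨hinj, hrev, hrot⟩
  refine ⟨⟨t, ht, htm⟩, ⟨B, hsimple, ?_, ?_⟩, isGluing_of_isCutMap
    (ι := ι) (inl := Sum.inl) (inr := Sum.inr) ⟨ht, ⟨hinj, hrev, hrot⟩, hroot, hrange⟩ hB⟩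
  · rw [hB.card_boundary ht, htm]
  · have h1 := hB.numInteriorEdges_add ht hsimple
    have h2 := X.numEdges_eq
    omega

open RootedMap in
theorem exists_decoratedMap_isGluing {e m : ℕ} (t : TreeRep m) (B : BoundaryMapRep e m) :
    ∃ X : DecoratedMapRep e m, IsGluing t B X := by
  classical
  obtain ⟨β, hinj, hrange, hroot, hcomm⟩ := exists_orbit_labelling (p := B.map.face)
    (q := t.map.contour) B.map.root t.map.root (t.isTree.sameCycle_contour _)
    (B.boundary_size.trans (by rw [card_dart, t.numEdges_eq]))
  change Set.range β = B.map.boundary at hrange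
  have hmem : ∀ c, β c ∈ B.map.boundary := fun c => hrange ▸ ⟨c, rfl⟩
  have hrevmem : ∀ c, B.map.rev (β c) ∉ B.map.boundary := fun c => B.simple.2 _ (hmem c)
  let D : Type := {d : B.map.Dart // d ∉ B.map.boundary}
  -- Gluing folds the boundary onto the rest: the boundary edges labelled `c` and `t.map.rev c` are
  -- glued in opposite directions, so `β c` becomes the reverse of `β (t.map.rev c)`, which is not
  -- on the boundary.
  have hex : ∀ d : B.map.Dart, ∃ x : D, (d ∉ B.map.boundary → x.1 = d) ∧
      ∀ c, β c = d → x.1 = B.map.rev (β (t.map.rev c)) := by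
    intro d
    by_cases hd : d ∈ B.map.boundary
    · obtain ⟨c, rfl⟩ : d ∈ Set.range β := hrange ▸ hd
      exact ⟨⟨_, hrevmem (t.map.rev c)⟩, fun h => absurd hd h, fun c' hc => by rw [hinj hc]⟩
    · exact ⟨⟨d, hd⟩, fun _ => rfl, fun c hc => absurd (hc ▸ hmem c) hd⟩
  choose f hfd hfβ using hex
  replace hfβ : ∀ c, (f (β c)).1 = B.map.rev (β (t.map.rev c)) := fun c => hfβ _ c rfl
  have hinv : Function.Involutive fun d : D => f (B.map.rev d.1) := by
    rintro ⟨d, hd⟩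
    refine Subtype.ext ?_
    change (f (B.map.rev (f (B.map.rev d)).1)).1 = d
    by_cases hd' : B.map.rev d ∈ B.map.boundary
    · obtain ⟨c, hc⟩ : B.map.rev d ∈ Set.range β := hrange ▸ hd'
      rw [← hc, hfβ, B.map.rev_rev, hfβ, t.map.rev_rev, hc, B.map.rev_rev]
    · rw [hfd _ hd', B.map.rev_rev, hfd _ hd]
  have hne : ∀ d : D, f (B.map.rev d.1) ≠ d := by
    rintro ⟨d, hd⟩ h
    replace h : (f (B.map.rev d)).1 = d := congrArg Subtype.val h
    by_cases hd' : B.map.rev d ∈ B.map.boundary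
    · obtain ⟨c, hc⟩ : B.map.rev d ∈ Set.range β := hrange ▸ hd'
      rw [← hc, hfβ] at h
      refine t.map.rev_ne c (hinj ?_)
      rw [hc, ← h, B.map.rev_rev]
    · rw [hfd _ hd'] at h
      exact B.map.rev_ne _ h
  -- The inner faces are kept, and the rotation of the glued map is then forced by its faces and its
  -- reversal.
  let F : Equiv.Perm D := B.map.face.subtypePerm fun d => not_congr face_mem_boundary_iff
  let S : RotationSystem D := ⟨hinv.toPerm, F * hinv.toPerm, hinv, hne⟩
  have hface : S.face = F := by
    have : hinv.toPerm * hinv.toPerm = 1 := Equiv.ext hinv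
    change F * hinv.toPerm * hinv.toPerm = _
    rw [mul_assoc, this, mul_one]
  have hcut : IsCut S t.map.rotationSystem B.map.rotationSystem (f ∘ β) Subtype.val β := {
    injective := fun c c' hc => by
      have := congrArg Subtype.val hc
      rw [Function.comp_apply, Function.comp_apply, hfβ, hfβ] at this
      exact t.map.rev.injective (hinj (B.map.rev.injective this))
    map_rev := fun c => Subtype.ext <| by
      change (f (β (t.map.rev c))).1 = (f (B.map.rev (f (β c)).1)).1
      rw [hfβ c, B.map.rev_rev]
    inl_injective := Subtype.val_injective
    inr_injective := hinj
    inl_ne_inr := fun d c h => d.2 (h ▸ hmem c)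
    cover := fun a => by
      by_cases ha : a ∈ B.map.boundary
      · rw [← hrange] at ha
        exact Or.inr ha
      · exact Or.inl ⟨⟨a, ha⟩, rfl⟩
    rev_inr := fun c => by
      change B.map.rev (β c) = (f (B.map.rev (f (β c)).1)).1
      rw [hfβ c, B.map.rev_rev, hfβ, t.map.rev_rev]
    rev_inl := fun d hd => by
      refine (hfd _ fun hb => hd ?_).symm
      obtain ⟨c, hc⟩ : B.map.rev d.1 ∈ Set.range β := by rwa [hrange]
      refine ⟨t.map.rev c, Subtype.ext ?_⟩
      rw [Function.comp_apply, hfβ, t.map.rev_rev, hc, B.map.rev_rev]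
    face_inl := fun d => by rw [hface]; rfl
    face_inr := fun c => (hcomm c).symm }
  -- Here simplicity of the boundary enters: no two boundary edges start at the same vertex, so the
  -- glued tree is a submap.
  have hrot : IsFirstReturn S.rot t.map.rot (f ∘ β) :=
    hcut.isFirstReturn_tree
      (isFirstReturn_one fun c c' h => B.simple.1 _ (hmem c) _ (hmem c') h)
  let X : RootedMap := {
    Dart := D
    finite_dart := inferInstance
    rev := S.rev
    rot := S.rot
    root := f (β t.map.root)
    rev_rev := S.rev_rev
    rev_ne := S.rev_ne
    connected := hcut.isConnected_of_cut hrot B.map.connected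
    euler := (hcut.isSpherical_iff hrot t.isTree t.map.euler).1 B.map.euler }
  have hX : IsCutMap X t.map B.map (f ∘ β) Subtype.val β := ⟨hcut, hroot⟩
  have hsub : IsRootedSubtree t.map X (Set.range (f ∘ β)) (f ∘ β) :=
    ⟨t.isTree, ⟨hcut.injective, hcut.map_rev, hrot⟩, rfl, rfl⟩
  have hedges : X.numEdges = e + m := by
    have h1 := hX.numInteriorEdges_add t.isTree B.simple
    rw [B.numInteriorEdges_eq, t.numEdges_eq] at h1
    exact h1.symm
  exact ⟨⟨X, hedges, Set.range (f ∘ β), t.map, t.numEdges_eq, f ∘ β, hsub⟩,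
    isGluing_of_isCutMap (ι := f ∘ β) (inl := Subtype.val) (inr := β) hsub hX⟩

/-! ### The bijection -/

theorem theorem2 (e m : ℕ) :
    ∃ Φ : TreeDecoratedMap e m ≃ PlaneTree m × SimpleBoundaryMap e m,
      ∀ (X : DecoratedMapRep e m) (t : TreeRep m) (B : BoundaryMapRep e m),
        Φ X.toTreeDecoratedMap = (t.toPlaneTree, B.toSimpleBoundaryMap) ↔ IsGluing t B X := by
  choose t B hglue using fun X : DecoratedMapRep e m => X.exists_isGluing
  -- `F` depends on chosen representatives and chosen cuts; `hF` characterises its values by gluing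
  -- alone, so the choices are immaterial.
  let F : TreeDecoratedMap e m → PlaneTree m × SimpleBoundaryMap e m := fun q =>
    ((t q.out).toPlaneTree, (B q.out).toSimpleBoundaryMap)
  have hF : ∀ (X : DecoratedMapRep e m) (t' : TreeRep m) (B' : BoundaryMapRep e m),
      F X.toTreeDecoratedMap = (t'.toPlaneTree, B'.toSimpleBoundaryMap) ↔ IsGluing t' B' X := by
    intro X t' B'
    have hout : (X.toTreeDecoratedMap).out ≈ X := Quotient.mk_out X
    constructor
    · intro h
      exact (hglue _).congr (Quotient.exact (congrArg Prod.fst h))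
        (Quotient.exact (congrArg Prod.snd h)) hout
    · intro h
      obtain ⟨h1, h2⟩ := (hglue _).tree_equiv_and_boundaryMap_equiv
        (h.congr (Setoid.refl _) (Setoid.refl _) (Setoid.symm hout))
      exact Prod.ext (Quotient.sound h1) (Quotient.sound h2)
  refine ⟨Equiv.ofBijective F ⟨fun x y hxy => ?_, ?_⟩, hF⟩
  · induction x using Quotient.inductionOn with
    | _ X =>
    induction y using Quotient.inductionOn with
    | _ Y =>
    have hY := (hF Y _ _).1 hxy.symm
    exact Quotient.sound (((hF X _ _).1 rfl).decoratedMap_equiv hY)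
  · rintro ⟨x, y⟩
    induction x using Quotient.inductionOn with
    | _ t' =>
    induction y using Quotient.inductionOn with
    | _ B' =>
    obtain ⟨X, hX⟩ := exists_decoratedMap_isGluing t' B'
    exact ⟨X.toTreeDecoratedMap, (hF X t' B').2 hX⟩
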